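/- Let $s\ge 2$ and let $f_1,\dots,f_s:\mathbb{R}\to\mathbb{R}$ be smooth functions. On $\mathbb{R}^{3s}$ with coordinates $(u_1,\dots,u_s,t_1,\dots,t_s,v_1,\dots,v_s)$ put $F(u):=f_1(u_1)+\dots+f_s(u_s)$ and $$g_F(\partial_i^u,\partial_j^u)=-2\delta_{ij}F(u)-2\delta_{ij}\sum_k u_kt_k,\qquad g_F(\partial_i^u,\partial_j^v)=g_F(\partial_j^v,\partial_i^u)=\delta_{ij},\qquad g_F(\partial_i^t,\partial_j^t)=-\delta_{ij},$$ $$g_F(\partial_i^u,\partial_j^t)=g_F(\partial_j^t,\partial_i^u)=g_F(\partial_i^t,\partial_j^v)=g_F(\partial_j^v,\partial_i^t)=g_F(\partial_i^v,\partial_j^v)=0 .$$ Notation. Let $g$ be a pseudo-Riemannian metric on a manifold of dimension $m\ge3$; signature $(p,q)$ means $p$ timelike and $q$ spacelike directions. Let $R(x,y,z,w)=g(R(x,y)z,w)$ with $R(x,y)=[\nabla_x,\nabla_y]-\nabla_{[x,y]}$ be its Riemann curvature tensor, $\rho(x,y)=\sum_{ij}g^{ij}R(x,e_i,e_j,y)$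 its Ricci tensor, $\tau=\sum_{ij}g^{ij}\rho(e_i,e_j)$ its scalar curvature, and $$\begin{aligned}W(x,y,z,w)={}&R(x,y,z,w)-\tfrac1{m-2}\{\rho(x,w)g(y,z)+g(x,w)\rho(y,z)\}+\tfrac1{m-2}\{\rho(x,z)g(y,w)+g(x,z)\rho(y,w)\}\\&+\tfrac{1}{(m-1)(m-2)}\tau\{g(x,w)g(y,z)-g(x,z)g(y,w)\}\end{aligned}$$ its Weyl conformal curvature tensor. The Jacobi operator $J_W(x)$ of a tangent vector $x$ is defined by $g(J_W(x)y,z)=W(y,x,x,z)$; the skew-symmetric curvature operator of an oriented spacelike or timelike $2$-plane $\pi$ with oriented orthonormal basis $\{e_1,e_2\}$ is defined by $g(W(\pi)x,y)=W(e_1,e_2,x,y)$. (A vector $x$ is spacelike if $g(x,x)>0$; a $2$-plane is spacelike, resp. timelike, if $g$ is positive, resp. negative, definite on it.) The metric is conformally spacelike (resp. timelike) Jordan Osserman if, at every point $P$, the Jordan normal form of $J_W(x)$ is the same for all tangent vectors $x$ at $P$ with $g(x,x)=1$ (resp. $-1$). It is conformally spacelike (resp. timelike) Jordan Ivanov-Petrova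 if, at every point $P$, the Jordan normal form of $W(\pi)$ is the same for all oriented spacelike (resp. timelike) $2$-planes $\pi$ at $P$. In both cases the form may vary with $P$. **Theorem 4.2.** $g_F$ is a smooth pseudo-Riemannian metric of signature $(2s,s)$ on $\mathbb{R}^{3s}$, and: 1. If $x$ is a spacelike tangent vector at any point, then $J_W(x)$ has rank $2s-2$, $J_W(x)^2$ has rank $s-1$, and $J_W(x)^3=0$. Moreover $g_F$ is conformally spacelike Jordan Osserman, but it is not conformally timelike Jordan Osserman. 2. If $\pi$ is an oriented spacelike $2$-plane at any point, then $W(\pi)$ has rank $4$, $W(\pi)^2$ has rank $2$, and $W(\pi)^3=0$. Moreover $g_F$ is conformally spacelike Jordan Ivanov-Petrova, but it is not conformally timelike Jordan Ivanov-Petrova. -/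

import Mathlib

open scoped ContDiff

noncomputable section

namespace WeylJordan

variable {ι : Type} [Fintype ι] [DecidableEq ι]

/-! ### Algebraic curvature tensors

The vector space is `ι → ℝ`, a scalar product on it is given by its Gram matrix `G`, and a
covariant `4`-tensor is given by its components. -/

/-- The scalar product `g(x, y)` with Gram matrix `G`. -/
def inner (G : Matrix ι ι ℝ) (x y : ι → ℝ) : ℝ :=
  ∑ i, ∑ j, G i j * x i * y j

/-- Signature `(p, q)`: some basis is orthonormal with `p` vectors of square `-1` and `q` vectors of
square `+1`. -/
def HasSignature (G : Matrix ι ι ℝ) (p q : ℕ) : Prop :=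
  ∃ b : Module.Basis (Fin p ⊕ Fin q) ℝ (ι → ℝ), ∀ i j,
    inner G (b i) (b j) = if i = j then Sum.elim (fun _ => -1) (fun _ => 1) i else 0

/-- Components `A i j k l = A(eᵢ, eⱼ, eₖ, eₗ)` of a covariant `4`-tensor. -/
abbrev Tensor4 (ι : Type) := ι → ι → ι → ι → ℝ

/-- The value `A(x, y, z, w)`. -/
def Tensor4.eval (A : Tensor4 ι) (x y z w : ι → ℝ) : ℝ :=
  ∑ i, ∑ j, ∑ k, ∑ l, A i j k l * x i * y j * z k * w l

/-- The Ricci tensor `ρ(eₐ, e_b) = ∑ gⁱʲ A(eₐ, eᵢ, eⱼ, e_b)`. -/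
def ricci (G : Matrix ι ι ℝ) (A : Tensor4 ι) (a b : ι) : ℝ :=
  ∑ i, ∑ j, G⁻¹ i j * A a i j b

/-- The scalar curvature `τ = ∑ gⁱʲ ρ(eᵢ, eⱼ)`. -/
def scalar (G : Matrix ι ι ℝ) (A : Tensor4 ι) : ℝ :=
  ∑ i, ∑ j, G⁻¹ i j * ricci G A i j

/-- The Weyl projection of an algebraic curvature tensor, in dimension `m ≥ 3`. -/
def weylProj (G : Matrix ι ι ℝ) (A : Tensor4 ι) : Tensor4 ι := fun x y z w =>
  let m : ℝ := Fintype.card ι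
  A x y z w
    - 1 / (m - 2) * (ricci G A x w * G y z + G x w * ricci G A y z)
    + 1 / (m - 2) * (ricci G A x z * G y w + G x z * ricci G A y w)
    + 1 / ((m - 1) * (m - 2)) * scalar G A * (G x w * G y z - G x z * G y w)

/-- The matrix of the endomorphism `T` with `g(T y, z) = B(y, z)`, where the bilinear form `B` has
components `B i j`. -/
def endOfForm (G B : Matrix ι ι ℝ) : Matrix ι ι ℝ := G⁻¹ * B.transpose

/-- `endOfForm` has its defining property whenever the scalar product is non-degenerate. -/
theorem inner_endOfForm (G B : Matrix ι ι ℝ) (hs : G.IsSymm) (hG : IsUnit G.det) (y z : ι → ℝ) :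
    inner G ((endOfForm G B).mulVec y) z = ∑ i, ∑ j, B i j * y i * z j := by
  have key : ∀ (C : Matrix ι ι ℝ) (u v : ι → ℝ),
      ∑ i, ∑ j, C i j * u i * v j = dotProduct (C.transpose.mulVec u) v := by
    intro C u v
    simp only [dotProduct, Matrix.mulVec, Matrix.transpose_apply, Finset.sum_mul]
    exact Finset.sum_comm
  rw [inner, key, key, Matrix.mulVec_mulVec, hs.eq, endOfForm, ← Matrix.mul_assoc,
    Matrix.mul_nonsing_inv G hG, Matrix.one_mul]

/-- The Jacobi operator: `g(J_A(x) y, z) = A(y, x, x, z)`. -/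
def jacobi (G : Matrix ι ι ℝ) (A : Tensor4 ι) (x : ι → ℝ) : Matrix ι ι ℝ :=
  endOfForm G (Matrix.of fun i j => A.eval (Pi.single i 1) x x (Pi.single j 1))

/-- The skew-symmetric curvature operator `A(π)` of the plane `π` with oriented orthonormal basis
`(e.1, e.2)`: `g(A(π) x, y) = A(e.1, e.2, x, y)`. -/
def skewOp (G : Matrix ι ι ℝ) (A : Tensor4 ι) (e : (ι → ℝ) × (ι → ℝ)) : Matrix ι ι ℝ :=
  endOfForm G (Matrix.of fun i j => A.eval e.1 e.2 (Pi.single i 1) (Pi.single j 1))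

/-- The oriented orthonormal bases of spacelike (`ε = 1`) or timelike (`ε = -1`) `2`-planes. Every
oriented plane of that type has such a basis, and each such basis spans and orients one. -/
def orthonormalPairs (G : Matrix ι ι ℝ) (ε : ℝ) : Set ((ι → ℝ) × (ι → ℝ)) :=
  {e | inner G e.1 e.1 = ε ∧ inner G e.2 e.2 = ε ∧ inner G e.1 e.2 = 0}

/-- The pseudo-sphere of unit spacelike (`ε = 1`) or timelike (`ε = -1`) vectors. -/
def pseudoSphere (G : Matrix ι ι ℝ) (ε : ℝ) : Set (ι → ℝ) :=
  {x | inner G x x = ε}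

/-! ### Jordan normal forms -/

/-- The data of a complex Jordan normal form: finitely many non-empty blocks. -/
structure JordanData where
  count : ℕ
  eigenvalue : Fin count → ℂ
  size : Fin count → ℕ
  size_pos : ∀ i, 0 < size i

/-- The `n × n` Jordan block with eigenvalue `c`. -/
def jordanBlock (c : ℂ) (n : ℕ) : Matrix (Fin n) (Fin n) ℂ :=
  Matrix.of fun i j => if i = j then c else if (i : ℕ) + 1 = j then 1 else 0

/-- The block diagonal matrix of the Jordan blocks. -/
def JordanData.toMatrix (D : JordanData) :
    Matrix ((i : Fin D.count) × Fin (D.size i)) ((i : Fin D.count) × Fin (D.size i)) ℂ :=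
  Matrix.blockDiagonal' fun i => jordanBlock (D.eigenvalue i) (D.size i)

/-- The real matrix `M` has Jordan normal form `D`: over `ℂ` it is similar to the Jordan matrix. -/
def HasJordanForm (M : Matrix ι ι ℝ) (D : JordanData) : Prop :=
  ∃ (P : Matrix ι ((i : Fin D.count) × Fin (D.size i)) ℂ)
    (Q : Matrix ((i : Fin D.count) × Fin (D.size i)) ι ℂ),
    P * Q = 1 ∧ Q * P = 1 ∧ M.map Complex.ofReal = P * D.toMatrix * Q

/-- The Jordan normal form of `T` is constant on `S`. -/
def JordanConstantOn {X : Type} (T : X → Matrix ι ι ℝ) (S : Set X) : Prop :=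
  ∃ D : JordanData, ∀ x ∈ S, HasJordanForm (T x) D

/-! ### Pseudo-Riemannian metrics on the coordinate space `ℝ^ι` -/

/-- `g` is a smooth pseudo-Riemannian metric of signature `(p, q)` on `ℝ^ι`, where
`g P i j = g_P(∂ᵢ, ∂ⱼ)`. -/
def IsPseudoRiemannian (g : (ι → ℝ) → Matrix ι ι ℝ) (p q : ℕ) : Prop :=
  (∀ i j, ContDiff ℝ ∞ fun P => g P i j) ∧ (∀ P, (g P).IsSymm) ∧ ∀ P, HasSignature (g P) p q

/-- The partial derivative `∂ᵢ φ` at `P`. -/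
def partialDeriv (i : ι) (φ : (ι → ℝ) → ℝ) (P : ι → ℝ) : ℝ :=
  fderiv ℝ φ P (Pi.single i 1)

/-- The Christoffel symbol `Γᵢⱼᵏ` of the Levi-Civita connection: `∇_{∂ᵢ} ∂ⱼ = ∑ₖ Γᵢⱼᵏ ∂ₖ`. -/
def christoffel (g : (ι → ℝ) → Matrix ι ι ℝ) (i j k : ι) (P : ι → ℝ) : ℝ :=
  1 / 2 * ∑ l, (g P)⁻¹ k l *
    (partialDeriv i (fun Q => g Q j l) P + partialDeriv j (fun Q => g Q i l) P
      - partialDeriv l (fun Q => g Q i j) P)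

/-- The component `Rᵢⱼₖˡ` of the curvature operator: `R(∂ᵢ, ∂ⱼ) ∂ₖ = ∑ₗ Rᵢⱼₖˡ ∂ₗ`, where
`R(X, Y) = ∇_X ∇_Y - ∇_Y ∇_X - ∇_[X, Y]`. -/
def curvOp (g : (ι → ℝ) → Matrix ι ι ℝ) (i j k l : ι) (P : ι → ℝ) : ℝ :=
  partialDeriv i (christoffel g j k l) P - partialDeriv j (christoffel g i k l) P
    + ∑ a, (christoffel g j k a P * christoffel g i a l P
      - christoffel g i k a P * christoffel g j a l P)

/-- The Riemann curvature tensor `R(x, y, z, w) = g(R(x, y) z, w)` at `P`. -/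
def riemann (g : (ι → ℝ) → Matrix ι ι ℝ) (P : ι → ℝ) : Tensor4 ι := fun i j k l =>
  ∑ a, curvOp g i j k a P * g P a l

/-- The Weyl conformal curvature tensor at `P`. -/
def weyl (g : (ι → ℝ) → Matrix ι ι ℝ) (P : ι → ℝ) : Tensor4 ι :=
  weylProj (g P) (riemann g P)

def ConformallySpacelikeJordanOsserman (g : (ι → ℝ) → Matrix ι ι ℝ) : Prop :=
  ∀ P, JordanConstantOn (jacobi (g P) (weyl g P)) (pseudoSphere (g P) 1)

def ConformallyTimelikeJordanOsserman (g : (ι → ℝ) → Matrix ι ι ℝ) : Prop :=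
  ∀ P, JordanConstantOn (jacobi (g P) (weyl g P)) (pseudoSphere (g P) (-1))

def ConformallySpacelikeJordanIvanovPetrova (g : (ι → ℝ) → Matrix ι ι ℝ) : Prop :=
  ∀ P, JordanConstantOn (skewOp (g P) (weyl g P)) (orthonormalPairs (g P) 1)

def ConformallyTimelikeJordanIvanovPetrova (g : (ι → ℝ) → Matrix ι ι ℝ) : Prop :=
  ∀ P, JordanConstantOn (skewOp (g P) (weyl g P)) (orthonormalPairs (g P) (-1))

/-! ### The metrics `g_F` on `ℝ^{3s}` -/

/-- The `3s` coordinates `(u₁, …, uₛ, t₁, …, tₛ, v₁, …, vₛ)`, in this order: `.inl i` is `uᵢ`,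
`.inr (.inl i)` is `tᵢ` and `.inr (.inr i)` is `vᵢ`. -/
abbrev Coord (s : ℕ) : Type := Fin s ⊕ Fin s ⊕ Fin s

/-- The metric `g_F`, with `F(u) = f₁(u₁) + ⋯ + fₛ(uₛ)`. -/
def gF {s : ℕ} (f : Fin s → ℝ → ℝ) (P : Coord s → ℝ) : Matrix (Coord s) (Coord s) ℝ :=
  Matrix.of fun
    | .inl i, .inl j => if i = j then
        -2 * (∑ k, f k (P (.inl k))) - 2 * ∑ k, P (.inl k) * P (.inr (.inl k)) else 0
    | .inl i, .inr (.inr j) => if i = j then 1 else 0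
    | .inr (.inr i), .inl j => if i = j then 1 else 0
    | .inr (.inl i), .inr (.inl j) => if i = j then -1 else 0
    | .inl _, .inr (.inl _) => 0
    | .inr (.inl _), .inl _ => 0
    | .inr (.inl _), .inr (.inr _) => 0
    | .inr (.inr _), .inr (.inl _) => 0
    | .inr (.inr _), .inr (.inr _) => 0

end WeylJordan

end

/-! Write `φ` for the common diagonal entry of the `u`-`u` block. The curvature tensor is the
Kulkarni–Nomizu product of `p = ∑ duᵢ²` and `q = 2 ∑ duᵢ dtᵢ + ∑ cᵢ duᵢ²`, where `cᵢ = fᵢ'' + |u|² /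
2`. The inverse metric pairs `u` only with `v`, and `t` only with `t`; since `p` and `q` involve no
`dv` and `q` has no `dt dt` term, every trace in the Ricci tensor vanishes. Hence the Weyl tensor
equals the Riemann tensor (`weyl_gF`).

Raising an index turns both families of operators into strictly block triangular matrices `blockNil
K S` (`jacobi_gF`, `skewOp_gF`). Here `K` depends only on the `u`-parts: `K = |ξ|² - ξ ξᵀ` for a
vector, of rank `s - 1` when `ξ ≠ 0`, and `K = ξ ξ'ᵀ - ξ' ξᵀ` for a plane, of rank `2` when `ξ, ξ'`
are independent. The cube is zero, and the square has the single block `-K²`, of rank `rank K`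
because `K` is real and symmetric or skew. The operator itself has rank `2 rank K`, because the
corner `S` is of the form `K X + Y K` and can be cleared (`rank_blockNil`).

A vector without `u`-part has square `-|t|² ≤ 0`. So spacelike vectors have nonzero `u`-part, the
`u`-parts of a spacelike plane are independent, and the ranks are constant. They determine the
Jordan form (`hasJordanForm_of_rank`). Timelike vectors and planes may lie in the `t`-directions,
where the operator is zero, or have `u`-parts for which it is not; this refutes the timelike
properties. -/

noncomputable section

namespace WeylJordan

section JordanForm

variable {ι : Type} [Fintype ι] [DecidableEq ι]

/-! ### Jordan form of a nilpotent matrix with blocks of sizes three and one -/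

/-- Block sizes: `r` blocks of size three and `m` blocks of size one. -/
abbrev blockSize (r m : ℕ) : Fin r ⊕ Fin m → ℕ := Sum.elim (fun _ => 3) (fun _ => 1)

/-- The nilpotent Jordan data with `r` blocks of size three and `m` blocks of size one. -/
def nilpotentData (r m : ℕ) : JordanData where
  count := r + m
  eigenvalue := fun _ => 0
  size := fun i => blockSize r m (finSumFinEquiv.symm i)
  size_pos := fun i => by
    rcases finSumFinEquiv.symm i with j | j <;> simp

/-- The chains `M² wᵢ, M wᵢ, wᵢ` together with the vectors `kⱼ`. -/
def jordanVec {r m : ℕ} (M : Matrix ι ι ℝ) (w : Fin r → ι → ℝ) (k : Fin m → ι → ℝ) :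
    ((x : Fin r ⊕ Fin m) × Fin (blockSize r m x)) → ι → ℝ
  | ⟨.inl i, j⟩ => (M ^ (2 - j.val)).mulVec (w i)
  | ⟨.inr i, _⟩ => k i

theorem sum_jordanVec_mul_jordanBlock {r m : ℕ} {M : Matrix ι ι ℝ} (hM : M ^ 3 = 0)
    (w : Fin r → ι → ℝ) (k : Fin m → ι → ℝ) (hk : ∀ i, M.mulVec (k i) = 0)
    (x : Fin r ⊕ Fin m) (j : Fin (blockSize r m x)) (a : ι) :
    ∑ j', (jordanVec M w k ⟨x, j'⟩ a : ℂ) * jordanBlock 0 (blockSize r m x) j' j =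
      ((M.mulVec (jordanVec M w k ⟨x, j⟩) a : ℝ) : ℂ) := by
  rcases x with i | i
  · change Fin 3 at j
    change ∑ j' : Fin 3, (((M ^ (2 - j'.val)).mulVec (w i) a : ℝ) : ℂ) * jordanBlock 0 3 j' j =
      ((M.mulVec ((M ^ (2 - j.val)).mulVec (w i)) a : ℝ) : ℂ)
    -- The ones of `jordanBlock` lie above the diagonal, so column `j` selects the chain vector `j -
    -- 1`; for `j = 0` the column is zero, matching `M ^ 3 = 0`.
    rw [Matrix.mulVec_mulVec, ← pow_succ']
    fin_cases j <;> simp [Fin.sum_univ_three, jordanBlock, hM]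
  · change Fin 1 at j
    change ∑ j' : Fin 1, ((k i a : ℝ) : ℂ) * jordanBlock 0 1 j' j = ((M.mulVec (k i) a : ℝ) : ℂ)
    rw [hk]
    simp [jordanBlock, Subsingleton.elim j 0]

/-- In a vanishing combination, `M ^ 2` kills all but the `w`-terms, and then `M` kills all but the
`M w`-terms. What remains lies in the range of `M ^ 2` plus the span of `k`, where disjointness
separates the two sums. -/
theorem linearIndependent_jordanVec {r m : ℕ} {M : Matrix ι ι ℝ} (hM : M ^ 3 = 0)
    (w : Fin r → ι → ℝ) (k : Fin m → ι → ℝ) (hk : ∀ i, M.mulVec (k i) = 0)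
    (hw : LinearIndependent ℝ fun i => (M ^ 2).mulVec (w i)) (hkl : LinearIndependent ℝ k)
    (hd : Disjoint (LinearMap.range (M ^ 2).mulVecLin) (Submodule.span ℝ (Set.range k))) :
    LinearIndependent ℝ (jordanVec M w k) := by
  rw [Fintype.linearIndependent_iff]
  intro g hg
  have split : ∑ i : Fin r, ∑ j : Fin 3, g ⟨.inl i, j⟩ • (M ^ (2 - j.val)).mulVec (w i) +
      ∑ i : Fin m, ∑ j : Fin 1, g ⟨.inr i, j⟩ • k i = 0 := by
    rw [Fintype.sum_sigma, Fintype.sum_sum_type] at hg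
    exact hg
  simp only [Fin.sum_univ_three, Fin.sum_univ_one, Finset.sum_add_distrib] at split
  have comb : ∀ (n : ℕ) (c : Fin r → ℝ), ∑ i, c i • (M ^ n).mulVec (w i) =
      (M ^ n).mulVec (∑ i, c i • w i) := by
    intro n c
    simp [Matrix.mulVec_sum, Matrix.mulVec_smul]
  have ker : ∀ c : Fin m → ℝ, M.mulVec (∑ i, c i • k i) = 0 := by
    intro c
    simp [Matrix.mulVec_sum, Matrix.mulVec_smul, hk]
  have zero : ∀ c : Fin r → ℝ, (M ^ 2).mulVec (∑ i, c i • w i) = 0 → ∀ i, c i = 0 := by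
    intro c hc
    rw [← comb] at hc
    exact Fintype.linearIndependent_iff.mp hw c hc
  set a : Fin r → ℝ := fun i => g ⟨.inl i, (2 : Fin 3)⟩
  set b : Fin r → ℝ := fun i => g ⟨.inl i, (1 : Fin 3)⟩
  set c : Fin r → ℝ := fun i => g ⟨.inl i, (0 : Fin 3)⟩
  set d : Fin m → ℝ := fun i => g ⟨.inr i, (0 : Fin 1)⟩
  have eq : (M ^ 2).mulVec (∑ i, c i • w i) + (M ^ 1).mulVec (∑ i, b i • w i) +
      (M ^ 0).mulVec (∑ i, a i • w i) + ∑ i, d i • k i = 0 := by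
    rw [← comb, ← comb, ← comb]; exact split
  have h4 : M ^ 4 = 0 := by rw [pow_succ, hM, zero_mul]
  have ha : ∀ i, a i = 0 := by
    apply zero
    have := congrArg (M ^ 2).mulVec eq
    rw [Matrix.mulVec_add, Matrix.mulVec_add, Matrix.mulVec_add, Matrix.mulVec_mulVec,
      Matrix.mulVec_mulVec, Matrix.mulVec_mulVec, ← pow_add, ← pow_add, ← pow_add, pow_two M,
      ← Matrix.mulVec_mulVec (∑ i, d i • k i), ker] at this
    simpa [hM, h4, ← pow_two] using this
  have hb : ∀ i, b i = 0 := by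
    apply zero
    have := congrArg M.mulVec eq
    rw [Matrix.mulVec_add, Matrix.mulVec_add, Matrix.mulVec_add, Matrix.mulVec_mulVec,
      Matrix.mulVec_mulVec, Matrix.mulVec_mulVec, ← pow_succ', ← pow_succ', ker] at this
    simpa [hM, ha] using this
  have hcd : (M ^ 2).mulVec (∑ i, c i • w i) + ∑ i, d i • k i = 0 := by
    simpa [ha, hb] using eq
  have hc0 : (M ^ 2).mulVec (∑ i, c i • w i) = 0 := by
    refine Submodule.disjoint_def.mp hd _ ⟨_, rfl⟩ ?_
    rw [eq_neg_of_add_eq_zero_left hcd]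
    exact Submodule.neg_mem _ (Submodule.sum_mem _ fun i _ =>
      Submodule.smul_mem _ _ (Submodule.subset_span ⟨i, rfl⟩))
  have hc := zero c hc0
  have hd0 : ∀ i, d i = 0 := by
    rw [hc0, zero_add] at hcd
    exact Fintype.linearIndependent_iff.mp hkl d hcd
  rintro ⟨i | i, j⟩
  · change Fin 3 at j
    fin_cases j
    exacts [hc i, hb i, ha i]
  · change Fin 1 at j
    fin_cases j
    exact hd0 i

/-- The range of `M ^ 2` lies in the kernel of `M`, which has dimension `r + m`. The `w` are
preimages of a basis of that range, and `k` is a basis of a complement within the kernel. -/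
theorem exists_jordan_chains {r m : ℕ} {M : Matrix ι ι ℝ} (hM : M ^ 3 = 0)
    (h2 : (M ^ 2).rank = r) (h1 : M.rank = 2 * r) (hm : Fintype.card ι = 3 * r + m) :
    ∃ (w : Fin r → ι → ℝ) (k : Fin m → ι → ℝ), (∀ i, M.mulVec (k i) = 0) ∧
      LinearIndependent ℝ (fun i => (M ^ 2).mulVec (w i)) ∧ LinearIndependent ℝ k ∧
      Disjoint (LinearMap.range (M ^ 2).mulVecLin) (Submodule.span ℝ (Set.range k)) := by
  generalize hR : LinearMap.range (M ^ 2).mulVecLin = R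
  have hN : ∀ x ∈ LinearMap.ker M.mulVecLin, M.mulVec x = 0 := fun x hx => hx
  have hRN : R ≤ LinearMap.ker M.mulVecLin := by
    rw [← hR]
    rintro _ ⟨x, rfl⟩
    simp [Matrix.mulVec_mulVec, ← pow_succ', hM]
  have hRr : Module.finrank ℝ R = r := by rw [← hR]; exact h2
  have hNr : Module.finrank ℝ (LinearMap.ker M.mulVecLin) = r + m := by
    have := LinearMap.finrank_range_add_finrank_ker M.mulVecLin
    rw [Module.finrank_pi, hm] at this
    change M.rank + _ = _ at this
    omega
  have hRw : ∀ x ∈ R, ∃ y, (M ^ 2).mulVec y = x := by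
    rw [← hR]; exact fun x hx => hx
  clear hR
  generalize LinearMap.ker M.mulVecLin = N at *
  obtain ⟨D, hD⟩ := Submodule.exists_isCompl R
  -- A complement in the whole space, cut down to `N`, is a complement within `N` by the modular
  -- law.
  obtain ⟨C, hCN, hdis, hsup⟩ : ∃ C : Submodule ℝ (ι → ℝ), C ≤ N ∧ Disjoint R C ∧ R ⊔ C = N :=
    ⟨D ⊓ N, inf_le_right, hD.disjoint.mono_right inf_le_left, by
      rw [← sup_inf_assoc_of_le _ hRN, hD.sup_eq_top, top_inf_eq]⟩
  have hCr : Module.finrank ℝ C = m := by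
    have := Submodule.finrank_sup_add_finrank_inf_eq R C
    rw [hsup, hdis.eq_bot, finrank_bot] at this
    omega
  let b := Module.finBasisOfFinrankEq ℝ R hRr
  let b' := Module.finBasisOfFinrankEq ℝ C hCr
  choose w hw using fun i => hRw _ (b i).2
  refine ⟨w, fun i => b' i, fun i => hN _ (hCN (b' i).2), ?_, ?_, ?_⟩
  · simp only [hw]
    exact b.linearIndependent.map' R.subtype (Submodule.ker_subtype _)
  · exact b'.linearIndependent.map' C.subtype (Submodule.ker_subtype _)
  · refine hdis.mono_right ?_
    rw [Submodule.span_le]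
    rintro _ ⟨i, rfl⟩
    exact (b' i).2

/-- The hypothesis `h` is the identity `M P = P D` read column by column, where `P` has columns `v`.
The similarity is real and is then mapped to `ℂ`. -/
theorem hasJordanForm_of_linearIndependent {M : Matrix ι ι ℝ} {D : JordanData}
    {v : ((i : Fin D.count) × Fin (D.size i)) → ι → ℝ} (hv : LinearIndependent ℝ v)
    (hcard : Fintype.card ((i : Fin D.count) × Fin (D.size i)) = Fintype.card ι)
    (h : ∀ i j a, ∑ j', (v ⟨i, j'⟩ a : ℂ) * jordanBlock (D.eigenvalue i) (D.size i) j' j =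
      ((M.mulVec (v ⟨i, j⟩) a : ℝ) : ℂ)) : HasJordanForm M D := by
  let b : Module.Basis _ ℝ (ι → ℝ) := Module.Basis.mk hv
    (le_of_eq (hv.span_eq_top_of_card_eq_finrank' (by rw [hcard, Module.finrank_pi])).symm)
  have hbv : ∀ p, b p = v p := fun p => Module.Basis.mk_apply _ _ p
  let e := Pi.basisFun ℝ ι
  have hPQ : e.toMatrix b * b.toMatrix e = 1 := e.toMatrix_mul_toMatrix_flip b
  have hQP : b.toMatrix e * e.toMatrix b = 1 := b.toMatrix_mul_toMatrix_flip e
  have hP : ∀ a p, e.toMatrix b a p = v p a := by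
    intro a p
    rw [Module.Basis.toMatrix_apply, hbv, Pi.basisFun_repr]
  generalize e.toMatrix b = P at hPQ hQP hP
  generalize b.toMatrix e = Q at hPQ hQP
  have hPQ' := congrArg (fun A => A.map Complex.ofRealHom) hPQ
  have hQP' := congrArg (fun A => A.map Complex.ofRealHom) hQP
  simp only [Matrix.map_mul, Matrix.map_one Complex.ofRealHom (map_zero _) (map_one _)]
    at hPQ' hQP'
  refine ⟨_, _, hPQ', hQP', ?_⟩
  have hMP : M.map Complex.ofRealHom * P.map Complex.ofRealHom =
      P.map Complex.ofRealHom * D.toMatrix := by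
    rw [← Matrix.map_mul]
    ext a ⟨i, j⟩
    rw [Matrix.mul_apply, Fintype.sum_sigma, Finset.sum_eq_single i]
    · simp only [JordanData.toMatrix, Matrix.blockDiagonal'_apply_eq, Matrix.map_apply, hP,
        Matrix.mul_apply]
      exact (h i j a).symm
    · intro i' _ hi'
      refine Finset.sum_eq_zero fun j' _ => ?_
      rw [JordanData.toMatrix, Matrix.blockDiagonal'_apply_ne _ _ _ hi', mul_zero]
    · simp
  change M.map Complex.ofRealHom = _
  rw [← hMP, Matrix.mul_assoc, hPQ', Matrix.mul_one]

/-- The index set of the Jordan data is that of `jordanVec`. -/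
def nilpotentIndexEquiv (r m : ℕ) :
    ((i : Fin (nilpotentData r m).count) × Fin ((nilpotentData r m).size i)) ≃
      ((x : Fin r ⊕ Fin m) × Fin (blockSize r m x)) :=
  Equiv.sigmaCongrLeft (β := fun x => Fin (blockSize r m x)) finSumFinEquiv.symm

/-- Blocks of size two number `rank M - 2 rank M²`, so `h1` and `h2` exclude them. -/
theorem hasJordanForm_of_rank {r m : ℕ} {M : Matrix ι ι ℝ} (hM : M ^ 3 = 0)
    (h2 : (M ^ 2).rank = r) (h1 : M.rank = 2 * r) (hm : Fintype.card ι = 3 * r + m) :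
    HasJordanForm M (nilpotentData r m) := by
  obtain ⟨w, k, hk, hw, hkl, hd⟩ := exists_jordan_chains hM h2 h1 hm
  refine hasJordanForm_of_linearIndependent
    ((linearIndependent_jordanVec hM w k hk hw hkl hd).comp _ (nilpotentIndexEquiv r m).injective)
    ?_ fun i j a => sum_jordanVec_mul_jordanBlock hM w k hk (finSumFinEquiv.symm i) j a
  rw [Fintype.card_congr (nilpotentIndexEquiv r m), hm]
  simp [mul_comm]

/-- A Jordan matrix similar to zero is zero. This is what distinguishes the timelike operators. -/
theorem HasJordanForm.eq_zero_of_zero {M : Matrix ι ι ℝ} {D : JordanData}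
    (h0 : HasJordanForm (0 : Matrix ι ι ℝ) D) (hM : HasJordanForm M D) : M = 0 := by
  obtain ⟨P, Q, hPQ, hQP, h⟩ := h0
  obtain ⟨P', Q', -, -, h'⟩ := hM
  have hD : D.toMatrix = 0 := by
    have := congrArg (fun A => Q * A * P) h
    simp only [Matrix.mul_assoc, hQP, Matrix.mul_one] at this
    rw [← Matrix.mul_assoc Q P, hQP, Matrix.one_mul,
      Matrix.map_zero Complex.ofReal Complex.ofReal_zero] at this
    simpa using this.symm
  rw [hD] at h'
  ext i j
  have := congrFun (congrFun h' i) j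
  simpa using this

end JordanForm

/-! ### Ranks of block triangular matrices -/

/-- The block matrix with rows `(0, 0, 0)`, `(-K, 0, 0)` and `(S, K, 0)`. -/
def blockNil {s : ℕ} (K S : Matrix (Fin s) (Fin s) ℝ) : Matrix (Coord s) (Coord s) ℝ :=
  Matrix.of fun
    | .inr (.inl i), .inl j => -K i j
    | .inr (.inr i), .inl j => S i j
    | .inr (.inr i), .inr (.inl j) => K i j
    | .inl _, _ => 0
    | .inr (.inl _), .inr _ => 0
    | .inr (.inr _), .inr (.inr _) => 0

/-- The block matrix whose only nonzero block is `K`, in the lower left corner. -/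
def blockCorner {s : ℕ} (K : Matrix (Fin s) (Fin s) ℝ) : Matrix (Coord s) (Coord s) ℝ :=
  Matrix.of fun
    | .inr (.inr i), .inl j => K i j
    | .inr (.inr _), .inr _ => 0
    | .inl _, _ => 0
    | .inr (.inl _), _ => 0

theorem blockNil_sq {s : ℕ} (K S : Matrix (Fin s) (Fin s) ℝ) :
    blockNil K S ^ 2 = blockCorner (-(K * K)) := by
  rw [pow_two]
  ext (i | i | i) (j | j | j) <;> simp [blockNil, blockCorner, Matrix.mul_apply]

theorem blockNil_cube {s : ℕ} (K S : Matrix (Fin s) (Fin s) ℝ) : blockNil K S ^ 3 = 0 := by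
  rw [pow_succ, blockNil_sq]
  ext (i | i | i) (j | j | j) <;> simp [blockNil, blockCorner, Matrix.mul_apply]

theorem rank_blockCorner {s : ℕ} (K : Matrix (Fin s) (Fin s) ℝ) :
    (blockCorner K).rank = K.rank := by
  let L : (Fin s → ℝ) →ₗ[ℝ] (Coord s → ℝ) :=
    { toFun := fun p => Sum.elim 0 (Sum.elim 0 p)
      map_add' := fun p q => by ext (i | i | i) <;> simp
      map_smul' := fun c p => by ext (i | i | i) <;> simp }
  have hL : Function.Injective L := fun p q h => by
    ext i; exact congrFun h (.inr (.inr i))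
  have : LinearMap.range (blockCorner K).mulVecLin = (LinearMap.range K.mulVecLin).map L := by
    ext z
    constructor
    · rintro ⟨x, rfl⟩
      refine ⟨_, ⟨fun i => x (.inl i), rfl⟩, ?_⟩
      ext (i | i | i) <;> simp [L, blockCorner, Matrix.mulVec, dotProduct]
    · rintro ⟨_, ⟨x, rfl⟩, rfl⟩
      refine ⟨Sum.elim x 0, ?_⟩
      ext (i | i | i) <;> simp [L, blockCorner, Matrix.mulVec, dotProduct]
  rw [Matrix.rank, this, ← (Submodule.equivMapOfInjective L hL _).finrank_eq, Matrix.rank]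

/-- Up to the injective shear `L` that absorbs `Y`, the image of `x` is the pair `(-K x_u, K (X x_u
+ x_t))`. Since `x_t` is free, the two entries range independently over the range of `K`. -/
theorem rank_blockNil {s : ℕ} {K S : Matrix (Fin s) (Fin s) ℝ} (X Y : Matrix (Fin s) (Fin s) ℝ)
    (hS : S = K * X + Y * K) : (blockNil K S).rank = 2 * K.rank := by
  let L : (Fin s → ℝ) × (Fin s → ℝ) →ₗ[ℝ] (Coord s → ℝ) :=
    { toFun := fun p => Sum.elim 0 (Sum.elim p.1 (p.2 - Y.mulVec p.1))
      map_add' := fun p q => by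
        ext (i | i | i) <;> simp [Matrix.mulVec_add]; ring
      map_smul' := fun c p => by
        ext (i | i | i) <;> simp [Matrix.mulVec_smul]; ring }
  have hL : Function.Injective L := fun p q h => by
    have h1 : p.1 = q.1 := by ext i; exact congrFun h (.inr (.inl i))
    refine Prod.ext h1 ?_
    ext i
    have := congrFun h (.inr (.inr i))
    simpa [L, h1] using this
  have hmul : ∀ x : Coord s → ℝ, (blockNil K S).mulVec x = L (-K.mulVec (fun i => x (.inl i)),
      K.mulVec (X.mulVec (fun i => x (.inl i)) + fun i => x (.inr (.inl i)))) := by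
    intro x
    have hSx : S.mulVec (fun i => x (.inl i)) = K.mulVec (X.mulVec fun i => x (.inl i)) +
        Y.mulVec (K.mulVec fun i => x (.inl i)) := by
      rw [hS, Matrix.add_mulVec, Matrix.mulVec_mulVec, Matrix.mulVec_mulVec]
    ext (i | i | i)
    · simp [L, blockNil, Matrix.mulVec, dotProduct]
    · simp [L, blockNil, Matrix.mulVec, dotProduct]
    · have h1 := congrFun hSx i
      have h2 : (blockNil K S).mulVec x (.inr (.inr i)) = S.mulVec (fun i => x (.inl i)) i +
          K.mulVec (fun i => x (.inr (.inl i))) i := by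
        simp [blockNil, Matrix.mulVec, dotProduct]
      rw [h2, h1]
      simp [L, Matrix.mulVec_add, Matrix.mulVec_neg]
      ring
  let ir := (LinearMap.range K.mulVecLin).subtype
  have hinj : Function.Injective (L ∘ₗ ir.prodMap ir) := by
    refine hL.comp ?_
    rintro ⟨p, q⟩ ⟨p', q'⟩ h
    exact Prod.ext (Subtype.ext (congrArg Prod.fst h)) (Subtype.ext (congrArg Prod.snd h))
  have : LinearMap.range (blockNil K S).mulVecLin = LinearMap.range (L ∘ₗ ir.prodMap ir) := by
    ext z
    constructor
    · rintro ⟨x, rfl⟩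
      rw [Matrix.mulVecLin_apply, hmul]
      exact ⟨⟨⟨-K.mulVec fun i => x (.inl i), ⟨-fun i => x (.inl i), by
        rw [Matrix.mulVecLin_apply, Matrix.mulVec_neg]⟩⟩,
        ⟨_, ⟨_, rfl⟩⟩⟩, rfl⟩
    · rintro ⟨⟨⟨_, ⟨x, rfl⟩⟩, ⟨_, ⟨y, rfl⟩⟩⟩, rfl⟩
      -- Solves `-K x_u = K x` and `K (X x_u + x_t) = K y`.
      refine ⟨Sum.elim (-x) (Sum.elim (y + X.mulVec x) 0), ?_⟩
      rw [Matrix.mulVecLin_apply, hmul]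
      change L _ = L (K.mulVec x, K.mulVec y)
      congr 1
      refine Prod.ext ?_ ?_
      · change -K.mulVec (-x) = K.mulVec x
        rw [Matrix.mulVec_neg, neg_neg]
      · change K.mulVec (X.mulVec (-x) + (y + X.mulVec x)) = K.mulVec y
        rw [Matrix.mulVec_neg]
        congr 1
        abel
  rw [Matrix.rank, this, LinearMap.finrank_range_of_inj hinj, Module.finrank_prod, ← two_mul]
  rfl

/-- The symmetric matrix `|ξ|² - ξ ξᵀ`. -/
def jacobiBlock {s : ℕ} (ξ : Fin s → ℝ) : Matrix (Fin s) (Fin s) ℝ :=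
  (ξ ⬝ᵥ ξ) • 1 - Matrix.vecMulVec ξ ξ

/-- The skew matrix `ξ ξ'ᵀ - ξ' ξᵀ`. -/
def skewBlock {s : ℕ} (ξ ξ' : Fin s → ℝ) : Matrix (Fin s) (Fin s) ℝ :=
  Matrix.vecMulVec ξ ξ' - Matrix.vecMulVec ξ' ξ

theorem rank_neg_mul_self_of_symm {s : ℕ} {K : Matrix (Fin s) (Fin s) ℝ} (h : K.transpose = K) :
    (-(K * K)).rank = K.rank := by
  have hu : IsUnit (-1 : Matrix (Fin s) (Fin s) ℝ).det :=
    (Matrix.isUnit_iff_isUnit_det _).mp isUnit_one.neg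
  rw [← neg_one_mul, Matrix.rank_mul_eq_right_of_isUnit_det _ _ hu]
  nth_rewrite 1 [← h]
  exact Matrix.rank_transpose_mul_self K

theorem rank_neg_mul_self_of_skew {s : ℕ} {K : Matrix (Fin s) (Fin s) ℝ} (h : K.transpose = -K) :
    (-(K * K)).rank = K.rank := by
  rw [← neg_mul, ← h]
  exact Matrix.rank_transpose_mul_self K

theorem jacobiBlock_mulVec {s : ℕ} (ξ α : Fin s → ℝ) :
    (jacobiBlock ξ).mulVec α = (ξ ⬝ᵥ ξ) • α - (ξ ⬝ᵥ α) • ξ := by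
  rw [jacobiBlock, Matrix.sub_mulVec, Matrix.smul_mulVec, Matrix.one_mulVec,
    Matrix.vecMulVec_mulVec]
  simp

theorem skewBlock_mulVec {s : ℕ} (ξ ξ' α : Fin s → ℝ) :
    (skewBlock ξ ξ').mulVec α = (ξ' ⬝ᵥ α) • ξ - (ξ ⬝ᵥ α) • ξ' := by
  rw [skewBlock, Matrix.sub_mulVec, Matrix.vecMulVec_mulVec, Matrix.vecMulVec_mulVec]
  simp

theorem jacobiBlock_transpose {s : ℕ} (ξ : Fin s → ℝ) :
    (jacobiBlock ξ).transpose = jacobiBlock ξ := by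
  simp [jacobiBlock, Matrix.transpose_vecMulVec]

theorem skewBlock_transpose {s : ℕ} (ξ ξ' : Fin s → ℝ) :
    (skewBlock ξ ξ').transpose = -skewBlock ξ ξ' := by
  simp [skewBlock, Matrix.transpose_vecMulVec]

theorem rank_jacobiBlock {s : ℕ} {ξ : Fin s → ℝ} (hξ : ξ ≠ 0) :
    (jacobiBlock ξ).rank = s - 1 := by
  have hn : ξ ⬝ᵥ ξ ≠ 0 := fun h => hξ (dotProduct_self_eq_zero.mp h)
  have hker : LinearMap.ker (jacobiBlock ξ).mulVecLin = Submodule.span ℝ {ξ} := by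
    ext α
    rw [LinearMap.mem_ker, Matrix.mulVecLin_apply, jacobiBlock_mulVec,
      Submodule.mem_span_singleton, sub_eq_zero]
    constructor
    · intro h
      refine ⟨(ξ ⬝ᵥ ξ)⁻¹ * (ξ ⬝ᵥ α), ?_⟩
      rw [mul_smul, ← h, smul_smul, inv_mul_cancel₀ hn, one_smul]
    · rintro ⟨c, rfl⟩
      rw [dotProduct_smul, smul_smul, smul_eq_mul, mul_comm]
  have := LinearMap.finrank_range_add_finrank_ker (jacobiBlock ξ).mulVecLin
  rw [hker, finrank_span_singleton hξ, Module.finrank_pi, Fintype.card_fin] at this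
  change (jacobiBlock ξ).rank + 1 = s at this
  omega

/-- Two linearly independent vectors have a dual pair. -/
theorem exists_dual_pair {s : ℕ} {ξ ξ' : Fin s → ℝ} (h : LinearIndependent ℝ ![ξ, ξ']) :
    ∃ θ θ' : Fin s → ℝ, ξ ⬝ᵥ θ = 1 ∧ ξ' ⬝ᵥ θ = 0 ∧ ξ ⬝ᵥ θ' = 0 ∧ ξ' ⬝ᵥ θ' = 1 := by
  set a := ξ ⬝ᵥ ξ with ha
  set b := ξ ⬝ᵥ ξ' with hb
  set c := ξ' ⬝ᵥ ξ' with hc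
  have hba : ξ' ⬝ᵥ ξ = b := dotProduct_comm _ _
  rw [LinearIndependent.pair_iff] at h
  -- Gram determinant: `|c ξ - b ξ'|² = c (a c - b²)`, so if it vanished, independence would force
  -- `c = |ξ'|² = 0`. The dual pair then comes from the inverse Gram matrix.
  have hne : a * c - b * b ≠ 0 := by
    intro h0
    have hv : (c • ξ + (-b) • ξ') = 0 := by
      rw [← dotProduct_self_eq_zero]
      simp only [add_dotProduct, dotProduct_add, smul_dotProduct, dotProduct_smul, smul_eq_mul,
        ← ha, ← hb, ← hc, hba]
      linear_combination c * h0
    have h1 := (h _ _ hv).1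
    have h2 : ξ' = 0 := dotProduct_self_eq_zero.mp h1
    have := h 0 1 (by simp [h2])
    simp at this
  refine ⟨(a * c - b * b)⁻¹ • (c • ξ - b • ξ'), (a * c - b * b)⁻¹ • (a • ξ' - b • ξ), ?_, ?_, ?_, ?_⟩ <;>
    simp only [dotProduct_sub, dotProduct_smul, smul_eq_mul, ← ha, ← hb, ← hc, hba]
  · linear_combination inv_mul_cancel₀ hne
  · ring
  · ring
  · linear_combination inv_mul_cancel₀ hne

theorem rank_skewBlock {s : ℕ} {ξ ξ' : Fin s → ℝ} (h : LinearIndependent ℝ ![ξ, ξ']) :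
    (skewBlock ξ ξ').rank = 2 := by
  obtain ⟨θ, θ', h1, h2, h3, h4⟩ := exists_dual_pair h
  have hr : LinearMap.range (skewBlock ξ ξ').mulVecLin =
      Submodule.span ℝ (Set.range ![ξ, ξ']) := by
    apply le_antisymm
    · rintro _ ⟨α, rfl⟩
      rw [Matrix.mulVecLin_apply, skewBlock_mulVec]
      exact Submodule.sub_mem _ (Submodule.smul_mem _ _ (Submodule.subset_span ⟨0, rfl⟩))
        (Submodule.smul_mem _ _ (Submodule.subset_span ⟨1, rfl⟩))
    · rw [Submodule.span_le]
      rintro _ ⟨i, rfl⟩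
      fin_cases i
      · exact ⟨θ', by simp [skewBlock_mulVec, h3, h4]⟩
      · exact ⟨-θ, by simp [skewBlock_mulVec, h1, h2]⟩
  rw [Matrix.rank, hr, finrank_span_eq_card h, Fintype.card_fin]

/-- A symmetric matrix with `ξᵀ S ξ = 0` has the form `Q X + Y Q` for `Q = |ξ|² - ξ ξᵀ`. -/
theorem exists_jacobiBlock_decomposition {s : ℕ} {ξ : Fin s → ℝ} (hξ : ξ ≠ 0)
    {S : Matrix (Fin s) (Fin s) ℝ} (hS : ξ ⬝ᵥ S.mulVec ξ = 0) :
    ∃ X Y, S = jacobiBlock ξ * X + Y * jacobiBlock ξ := by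
  set n := ξ ⬝ᵥ ξ with hn
  have hn0 : n ≠ 0 := fun h => hξ (dotProduct_self_eq_zero.mp h)
  -- With `Π = ξ ξᵀ` and `Q = n - Π`, one has `n S = Q S + Π S` and `n Π S = Π S Q + Π S Π`, where
  -- `Π S Π = 0` by `hS`.
  refine ⟨n⁻¹ • S, (n⁻¹ * n⁻¹) • (Matrix.vecMulVec ξ ξ * S), ?_⟩
  have h0 : Matrix.vecMulVec ξ ξ * S * Matrix.vecMulVec ξ ξ = 0 := by
    rw [Matrix.mul_assoc, Matrix.mul_vecMulVec, Matrix.vecMulVec_mul_vecMulVec, hS]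
    simp
  rw [jacobiBlock, ← hn, Matrix.mul_sub, Matrix.sub_mul, Matrix.smul_mul (n⁻¹ * n⁻¹) _ (Matrix.vecMulVec ξ ξ), h0]
  simp only [Matrix.smul_mul, Matrix.mul_smul, Matrix.one_mul, Matrix.mul_one, smul_smul, smul_zero, sub_zero]
  rw [inv_mul_cancel₀ hn0, mul_inv_cancel_left₀ hn0]
  simp

theorem exists_skewBlock_decomposition {s : ℕ} {ξ ξ' : Fin s → ℝ}
    (h : LinearIndependent ℝ ![ξ, ξ']) (ζ ζ' : Fin s → ℝ) :
    ∃ X Y, Matrix.vecMulVec ζ ξ' - Matrix.vecMulVec ξ' ζ + Matrix.vecMulVec ξ ζ' -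
      Matrix.vecMulVec ζ' ξ = skewBlock ξ ξ' * X + Y * skewBlock ξ ξ' := by
  obtain ⟨θ, θ', h1, h2, h3, h4⟩ := exists_dual_pair h
  rw [dotProduct_comm] at h1 h2 h3 h4
  -- For `K = skewBlock ξ ξ'`: `K θ' = ξ`, `K θ = -ξ'`, `θᵀ K = ξ'ᵀ` and `θ'ᵀ K = -ξᵀ`.
  refine ⟨Matrix.vecMulVec θ ζ + Matrix.vecMulVec θ' ζ',
    Matrix.vecMulVec ζ θ + Matrix.vecMulVec ζ' θ', ?_⟩
  simp only [skewBlock, Matrix.mul_add, Matrix.add_mul, Matrix.sub_mul, Matrix.mul_sub,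
    Matrix.vecMulVec_mul_vecMulVec, h1, h2, h3, h4, dotProduct_comm ξ θ, dotProduct_comm ξ' θ,
    dotProduct_comm ξ θ', dotProduct_comm ξ' θ']
  simp
  abel

/-! ### Partial derivatives -/

section PartialDerivatives
variable {ι : Type} [DecidableEq ι]

theorem partialDeriv_const (i : ι) (c : ℝ) (P : ι → ℝ) : partialDeriv i (fun _ => c) P = 0 := by
  simp [partialDeriv]

theorem partialDeriv_coord (i j : ι) (P : ι → ℝ) :
    partialDeriv i (fun Q => Q j) P = if j = i then 1 else 0 := by
  rw [partialDeriv, (hasFDerivAt_apply j P).fderiv]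
  simp [Pi.single_apply]

variable [Fintype ι]

theorem partialDeriv_comp_coord (i j : ι) {h : ℝ → ℝ} (P : ι → ℝ)
    (hh : DifferentiableAt ℝ h (P j)) :
    partialDeriv i (fun Q => h (Q j)) P = if j = i then deriv h (P j) else 0 := by
  have := hh.hasDerivAt.comp_hasFDerivAt P (hasFDerivAt_apply (𝕜 := ℝ) j P)
  rw [partialDeriv]
  erw [this.fderiv]
  simp [Pi.single_apply]

theorem partialDeriv_const_mul (i : ι) (c : ℝ) {φ : (ι → ℝ) → ℝ} {P : ι → ℝ}
    (hφ : DifferentiableAt ℝ φ P) :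
    partialDeriv i (fun Q => c * φ Q) P = c * partialDeriv i φ P := by
  simp [partialDeriv, fderiv_const_mul hφ]

theorem partialDeriv_mul (i : ι) {φ χ : (ι → ℝ) → ℝ} {P : ι → ℝ}
    (hφ : DifferentiableAt ℝ φ P) (hχ : DifferentiableAt ℝ χ P) :
    partialDeriv i (fun Q => φ Q * χ Q) P = φ P * partialDeriv i χ P + χ P * partialDeriv i φ P := by
  simp [partialDeriv, fderiv_fun_mul hφ hχ]

theorem partialDeriv_add (i : ι) {φ χ : (ι → ℝ) → ℝ} {P : ι → ℝ}
    (hφ : DifferentiableAt ℝ φ P) (hχ : DifferentiableAt ℝ χ P) :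
    partialDeriv i (fun Q => φ Q + χ Q) P = partialDeriv i φ P + partialDeriv i χ P := by
  simp [partialDeriv, fderiv_fun_add hφ hχ]

theorem partialDeriv_sub (i : ι) {φ χ : (ι → ℝ) → ℝ} {P : ι → ℝ}
    (hφ : DifferentiableAt ℝ φ P) (hχ : DifferentiableAt ℝ χ P) :
    partialDeriv i (fun Q => φ Q - χ Q) P = partialDeriv i φ P - partialDeriv i χ P := by
  simp [partialDeriv, fderiv_fun_sub hφ hχ]

theorem partialDeriv_sum {κ : Type} [Fintype κ] (i : ι) {φ : κ → (ι → ℝ) → ℝ} {P : ι → ℝ}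
    (hφ : ∀ k, DifferentiableAt ℝ (φ k) P) :
    partialDeriv i (fun Q => ∑ k, φ k Q) P = ∑ k, partialDeriv i (φ k) P := by
  simp [partialDeriv, fderiv_fun_sum fun k _ => hφ k]

end PartialDerivatives

/-! ### The metric and its inverse -/

variable {s : ℕ} {f : Fin s → ℝ → ℝ}

/-- The common diagonal entry `-2 F(u) - 2 ∑ uₖ tₖ` of the metric. -/
def metricPotential (f : Fin s → ℝ → ℝ) (P : Coord s → ℝ) : ℝ :=
  -2 * (∑ k, f k (P (.inl k))) - 2 * ∑ k, P (.inl k) * P (.inr (.inl k))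

/-- The inverse of `gF`. -/
def gFInv (f : Fin s → ℝ → ℝ) (P : Coord s → ℝ) : Matrix (Coord s) (Coord s) ℝ :=
  Matrix.of fun
    | .inl i, .inr (.inr j) => if i = j then 1 else 0
    | .inr (.inr i), .inl j => if i = j then 1 else 0
    | .inr (.inr i), .inr (.inr j) => if i = j then -metricPotential f P else 0
    | .inr (.inl i), .inr (.inl j) => if i = j then -1 else 0
    | .inl _, .inl _ => 0
    | .inl _, .inr (.inl _) => 0
    | .inr (.inl _), .inl _ => 0
    | .inr (.inl _), .inr (.inr _) => 0
    | .inr (.inr _), .inr (.inl _) => 0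

theorem gF_mul_gFInv (P : Coord s → ℝ) : gF f P * gFInv f P = 1 := by
  ext (i | i | i) (j | j | j) <;>
    simp [gF, gFInv, Matrix.mul_apply, Matrix.one_apply, metricPotential]
  · split_ifs <;> ring
  · split_ifs <;> simp

theorem gF_inv (P : Coord s → ℝ) : (gF f P)⁻¹ = gFInv f P :=
  Matrix.inv_eq_right_inv (gF_mul_gFInv P)

theorem gF_isSymm (P : Coord s → ℝ) : (gF f P).IsSymm := by
  ext (i | i | i) (j | j | j) <;> simp [gF, eq_comm]

/-- The partial derivatives of the metric potential. -/
def metricPotentialDeriv (f : Fin s → ℝ → ℝ) (P : Coord s → ℝ) : Coord s → ℝ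
  | .inl k => -2 * deriv (f k) (P (.inl k)) - 2 * P (.inr (.inl k))
  | .inr (.inl k) => -2 * P (.inl k)
  | .inr (.inr _) => 0

theorem partialDeriv_metricPotential (hf : ∀ i, ContDiff ℝ ∞ (f i)) (l : Coord s)
    (P : Coord s → ℝ) : partialDeriv l (metricPotential f) P = metricPotentialDeriv f P l := by
  have hd : ∀ k x, DifferentiableAt ℝ (f k) x := fun k x =>
    ((hf k).differentiable (by simp)).differentiableAt
  have hd' : ∀ k (Q : Coord s → ℝ), DifferentiableAt ℝ (fun Q : Coord s → ℝ => f k (Q (.inl k))) Q :=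
    fun k Q => (hd k _).comp Q (differentiableAt_apply _ _)
  unfold metricPotential
  rw [partialDeriv_sub, partialDeriv_const_mul, partialDeriv_const_mul, partialDeriv_sum,
    partialDeriv_sum]
  · simp only [partialDeriv_comp_coord _ _ _ (hd _ _)]
    have : ∀ k : Fin s, partialDeriv l (fun Q : Coord s → ℝ => Q (.inl k) * Q (.inr (.inl k))) P =
        P (.inl k) * (if (.inr (.inl k) : Coord s) = l then 1 else 0) +
        P (.inr (.inl k)) * (if (.inl k : Coord s) = l then 1 else 0) := by
      intro k
      rw [partialDeriv_mul _ (by fun_prop) (by fun_prop), partialDeriv_coord, partialDeriv_coord]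
    simp only [this]
    rcases l with l | l | l <;> simp [metricPotentialDeriv]
  all_goals fun_prop

theorem partialDeriv_gF (hf : ∀ i, ContDiff ℝ ∞ (f i)) (l a b : Coord s) (P : Coord s → ℝ) :
    partialDeriv l (fun Q => gF f Q a b) P =
      match a, b with
      | .inl i, .inl j => if i = j then metricPotentialDeriv f P l else 0
      | .inl _, .inr _ => 0
      | .inr _, _ => 0 := by
  rcases a with i | i | i <;> rcases b with j | j | j
  · by_cases h : i = j
    · simp only [if_pos h, gF, Matrix.of_apply]
      exact partialDeriv_metricPotential hf l P
    · simp only [if_neg h, gF, Matrix.of_apply]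
      exact partialDeriv_const _ _ _
  all_goals exact partialDeriv_const _ _ _

/-- Half of the derivative of the metric potential in the direction `uₖ`. -/
def slope (f : Fin s → ℝ → ℝ) (k : Fin s) (P : Coord s → ℝ) : ℝ :=
  -1 * deriv (f k) (P (.inl k)) - P (.inr (.inl k))

/-- The Kronecker symbol. -/
def delta (i j : Fin s) : ℝ := if i = j then 1 else 0

theorem delta_comm (i j : Fin s) : delta i j = delta j i := by
  simp [delta, eq_comm]

theorem delta_mul_eq (A : Fin s → ℝ) (i j : Fin s) : delta i j * A i = delta i j * A j := by
  rw [delta]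
  split_ifs with h <;> simp [h]

/-- The Christoffel symbols of `gF`. -/
def chris (f : Fin s → ℝ → ℝ) : Coord s → Coord s → Coord s → (Coord s → ℝ) → ℝ
  | .inl i, .inl j, .inr (.inl k) => fun P => -delta i j * P (.inl k)
  | .inl i, .inl j, .inr (.inr k) => fun P =>
      delta j k * slope f i P + delta i k * slope f j P - delta i j * slope f k P
  | .inl i, .inr (.inl j), .inr (.inr k) => fun P => -delta i k * P (.inl j)
  | .inr (.inl i), .inl j, .inr (.inr k) => fun P => -delta j k * P (.inl i)
  | .inl _, .inl _, .inl _ => fun _ => 0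
  | .inl _, .inr (.inl _), .inl _ => fun _ => 0
  | .inl _, .inr (.inl _), .inr (.inl _) => fun _ => 0
  | .inl _, .inr (.inr _), _ => fun _ => 0
  | .inr (.inl _), .inl _, .inl _ => fun _ => 0
  | .inr (.inl _), .inl _, .inr (.inl _) => fun _ => 0
  | .inr (.inl _), .inr _, _ => fun _ => 0
  | .inr (.inr _), _, _ => fun _ => 0

/-- Only the `u`-`u` entries vary, and they do not depend on `v`. Lowered symbols with last index
`v` therefore vanish, so the `v`-`v` block of the inverse, where `φ` itself occurs, contributes
nothing. -/
theorem christoffel_gF (hf : ∀ i, ContDiff ℝ ∞ (f i)) (i j k : Coord s) :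
    christoffel (gF f) i j k = chris f i j k := by
  funext P
  rw [christoffel, gF_inv]
  simp only [partialDeriv_gF hf]
  rcases i with i | i | i <;> rcases j with j | j | j <;> rcases k with k | k | k <;>
    simp [gFInv, chris, metricPotentialDeriv, slope, delta]
  all_goals split_ifs <;> subst_vars <;> first | ring1 | simp_all

theorem differentiableAt_slope (hf : ∀ i, ContDiff ℝ ∞ (f i)) (k : Fin s) (P : Coord s → ℝ) :
    DifferentiableAt ℝ (slope f k) P := by
  have hd : Differentiable ℝ (deriv (f k)) :=
    ((hf k).iterate_deriv 1).differentiable (by simp)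
  unfold slope
  have : DifferentiableAt ℝ (fun Q : Coord s → ℝ => deriv (f k) (Q (.inl k))) P :=
    hd.differentiableAt.comp P (differentiableAt_apply _ _)
  fun_prop

theorem partialDeriv_slope (hf : ∀ i, ContDiff ℝ ∞ (f i)) (l : Coord s) (k : Fin s)
    (P : Coord s → ℝ) : partialDeriv l (slope f k) P =
      match l with
      | .inl i => -delta k i * deriv (deriv (f k)) (P (.inl k))
      | .inr (.inl i) => -delta k i
      | .inr (.inr _) => 0 := by
  have hd : Differentiable ℝ (deriv (f k)) :=
    ((hf k).iterate_deriv 1).differentiable (by simp)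
  have hc : DifferentiableAt ℝ (fun Q : Coord s → ℝ => deriv (f k) (Q (.inl k))) P :=
    hd.differentiableAt.comp P (differentiableAt_apply _ _)
  unfold slope
  rw [partialDeriv_sub _ (by fun_prop) (by fun_prop), partialDeriv_const_mul _ _ hc,
    partialDeriv_comp_coord _ _ _ hd.differentiableAt, partialDeriv_coord]
  rcases l with i | i | i <;> simp [delta]
  split_ifs <;> simp

theorem partialDeriv_slopes (hf : ∀ i, ContDiff ℝ ∞ (f i)) (l : Coord s) (a b c : ℝ)
    (i j k : Fin s) (P : Coord s → ℝ) :
    partialDeriv l (fun Q => a * slope f i Q + b * slope f j Q - c * slope f k Q) P =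
      a * partialDeriv l (slope f i) P + b * partialDeriv l (slope f j) P -
        c * partialDeriv l (slope f k) P := by
  have h := fun k => differentiableAt_slope hf k P
  rw [partialDeriv_sub _ (((h i).const_mul a).fun_add ((h j).const_mul b)) ((h k).const_mul c),
    partialDeriv_add _ ((h i).const_mul a) ((h j).const_mul b),
    partialDeriv_const_mul _ _ (h i), partialDeriv_const_mul _ _ (h j),
    partialDeriv_const_mul _ _ (h k)]

theorem partialDeriv_const_mul_coord (l j : Coord s) (c : ℝ) (P : Coord s → ℝ) :
    partialDeriv l (fun Q => c * Q j) P = c * if j = l then 1 else 0 := by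
  rw [partialDeriv_const_mul _ _ (by fun_prop), partialDeriv_coord]

/-! ### The curvature tensor -/

/-- The symmetric form `∑ duᵢ²`. -/
def formP (s : ℕ) : Matrix (Coord s) (Coord s) ℝ :=
  Matrix.of fun
    | .inl i, .inl j => delta i j
    | .inl _, .inr _ => 0
    | .inr _, _ => 0

/-- The coefficients of `duᵢ²` in `formQ`. -/
def coeffQ (f : Fin s → ℝ → ℝ) (P : Coord s → ℝ) (i : Fin s) : ℝ :=
  deriv (deriv (f i)) (P (.inl i)) + 1 / 2 * ∑ k, P (.inl k) * P (.inl k)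

/-- The symmetric form `2 ∑ duᵢ dtᵢ + ∑ cᵢ duᵢ²`. -/
def formQ (c : Fin s → ℝ) : Matrix (Coord s) (Coord s) ℝ :=
  Matrix.of fun
    | .inl i, .inl j => delta i j * c i
    | .inl i, .inr (.inl j) => delta i j
    | .inr (.inl i), .inl j => delta i j
    | .inl _, .inr (.inr _) => 0
    | .inr (.inl _), .inr _ => 0
    | .inr (.inr _), _ => 0

theorem formP_inr_left (i : Fin s ⊕ Fin s) (a : Coord s) : formP s (.inr i) a = 0 := rfl

theorem formP_inr_right (i : Fin s ⊕ Fin s) (a : Coord s) : formP s a (.inr i) = 0 := by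
  rcases a with a | a <;> rfl

theorem formQ_v_left (c : Fin s → ℝ) (i : Fin s) (a : Coord s) :
    formQ c (.inr (.inr i)) a = 0 := rfl

theorem formQ_v_right (c : Fin s → ℝ) (i : Fin s) (a : Coord s) :
    formQ c a (.inr (.inr i)) = 0 := by
  rcases a with a | a | a <;> rfl

theorem formQ_t_t (c : Fin s → ℝ) (i j : Fin s) :
    formQ c (.inr (.inl i)) (.inr (.inl j)) = 0 := rfl

/-- The Kulkarni–Nomizu product of two symmetric forms. -/
def kulkarniNomizu {ι : Type} (p q : Matrix ι ι ℝ) : Tensor4 ι := fun i j k l =>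
  p j k * q i l + q j k * p i l - p i k * q j l - q i k * p j l

/-- This is the Kulkarni–Nomizu tensor with its last index raised: the `t`-component takes the sign
of `g(∂t, ∂t) = -1`, and the `v`-component reads off the `u`-slot. -/
theorem curvOp_gF (hf : ∀ i, ContDiff ℝ ∞ (f i)) (i j k l : Coord s) (P : Coord s → ℝ) :
    curvOp (gF f) i j k l P =
      match l with
      | .inl _ => 0
      | .inr (.inl l) => -kulkarniNomizu (formP s) (formQ (coeffQ f P)) i j k (.inr (.inl l))
      | .inr (.inr l) => kulkarniNomizu (formP s) (formQ (coeffQ f P)) i j k (.inl l) := by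
  rw [curvOp]
  simp only [christoffel_gF hf]
  rcases i with i | i | i <;> rcases j with j | j | j <;> rcases k with k | k | k <;>
    rcases l with l | l | l <;>
    simp only [chris, partialDeriv_slopes hf, partialDeriv_slope hf, partialDeriv_const,
      partialDeriv_const_mul_coord, Fintype.sum_sum_type, kulkarniNomizu, formP, formQ,
      Matrix.of_apply, mul_zero, zero_mul, add_zero, zero_add, sub_zero, sub_self, neg_zero,
      Finset.sum_const_zero, zero_sub, Sum.inl.injEq, reduceCtorEq, if_false]
  · change -delta j k * delta l i - -delta i k * delta l j = -(_)
    rw [delta_comm l i, delta_comm l j]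
    ring
  -- The products of Christoffel symbols give `|u|²` times `δⱼₖ δᵢₗ - δᵢₖ δⱼₗ`. The product of
  -- `formP` with itself is twice that tensor, whence the `1 / 2` in `coeffQ`.
  · have hsum : ∀ a b c d : ℝ, ∑ x, (-a * P (.inl x) * (-b * P (.inl x)) -
        -c * P (.inl x) * (-d * P (.inl x))) = (a * b - c * d) * ∑ x, P (.inl x) * P (.inl x) := by
      intro a b c d
      rw [Finset.mul_sum]
      exact Finset.sum_congr rfl fun x _ => by ring
    let A : Fin s → ℝ := fun i => deriv (deriv (f i)) (P (.inl i))
    rw [hsum, delta_comm j i, delta_comm k i, delta_comm l i, delta_comm k j, delta_comm l j,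
      coeffQ, coeffQ]
    -- The Hessian of `F` is diagonal, so `fᵢ''` may be moved between indices identified by a
    -- Kronecker symbol.
    linear_combination delta k l * delta_mul_eq A i j + delta j l * delta_mul_eq A i k -
      delta j k * delta_mul_eq A i l - delta i l * delta_mul_eq A j k +
      delta i k * delta_mul_eq A j l
  · change -delta j l * delta k i - -delta i l * delta k j = _
    rw [delta_comm k i, delta_comm k j]
    ring
  · change -delta k l * delta j i - _ = _
    rw [delta_comm j i, delta_comm k j, delta_comm l j]
    ring
  · change _ - -delta k l * delta i j = _
    rw [delta_comm j i, delta_comm k i, delta_comm l i]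
    ring

theorem riemann_gF (hf : ∀ i, ContDiff ℝ ∞ (f i)) (P : Coord s → ℝ) :
    riemann (gF f) P = kulkarniNomizu (formP s) (formQ (coeffQ f P)) := by
  funext i j k l
  rw [riemann]
  simp only [curvOp_gF hf, Fintype.sum_sum_type]
  rcases l with l | l | l
  · simp [gF]
  · simp [gF]
  · simp [gF, kulkarniNomizu, formP_inr_right, formQ_v_right]

theorem ricci_kulkarniNomizu (c : Fin s → ℝ) (P : Coord s → ℝ) (a b : Coord s) :
    ricci (gF f P) (kulkarniNomizu (formP s) (formQ c)) a b = 0 := by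
  rw [ricci, gF_inv]
  simp [Fintype.sum_sum_type, gFInv, kulkarniNomizu, formP_inr_left, formP_inr_right, formQ_v_left,
    formQ_v_right, formQ_t_t]

theorem weyl_gF (hf : ∀ i, ContDiff ℝ ∞ (f i)) (P : Coord s → ℝ) :
    weyl (gF f) P = kulkarniNomizu (formP s) (formQ (coeffQ f P)) := by
  funext i j k l
  simp [weyl, riemann_gF hf, weylProj, scalar, ricci_kulkarniNomizu]

/-! ### The curvature operators -/

theorem eval_kulkarniNomizu {ι : Type} [Fintype ι] (p q : Matrix ι ι ℝ) (x y z w : ι → ℝ) :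
    (kulkarniNomizu p q).eval x y z w =
      inner p y z * inner q x w + inner q y z * inner p x w -
        inner p x z * inner q y w - inner q x z * inner p y w := by
  have h1 : ∀ b c : Matrix ι ι ℝ, ∑ i, ∑ j, ∑ k, ∑ l, (b j k * y j * z k) * (c i l * x i * w l) =
      inner b y z * inner c x w := by
    intro b c
    simp only [← Finset.mul_sum, ← Finset.sum_mul, inner]
  have h2 : ∀ b c : Matrix ι ι ℝ, ∑ i, ∑ j, ∑ k, ∑ l, (b i k * x i * z k) * (c j l * y j * w l) =
      inner b x z * inner c y w := by
    intro b c
    simp only [← Finset.mul_sum, ← Finset.sum_mul, inner]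
  rw [Tensor4.eval, ← h1, ← h1, ← h2, ← h2]
  simp only [← Finset.sum_add_distrib, ← Finset.sum_sub_distrib]
  refine Finset.sum_congr rfl fun i _ => Finset.sum_congr rfl fun j _ =>
    Finset.sum_congr rfl fun k _ => Finset.sum_congr rfl fun l _ => ?_
  rw [kulkarniNomizu]
  ring

theorem inner_single_left {ι : Type} [Fintype ι] [DecidableEq ι] (B : Matrix ι ι ℝ) (i : ι)
    (y : ι → ℝ) : inner B (Pi.single i 1) y = B.mulVec y i := by
  rw [inner, Finset.sum_eq_single i]
  · simp [Matrix.mulVec, dotProduct]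
  · intro j _ hj
    simp [hj]
  · simp

theorem inner_comm {ι : Type} [Fintype ι] {B : Matrix ι ι ℝ} (hB : B.IsSymm) (x y : ι → ℝ) :
    inner B x y = inner B y x := by
  rw [inner, inner, Finset.sum_comm]
  refine Finset.sum_congr rfl fun i _ => Finset.sum_congr rfl fun j _ => ?_
  rw [hB.apply i j]
  ring

theorem inner_single_right {ι : Type} [Fintype ι] [DecidableEq ι] {B : Matrix ι ι ℝ}
    (hB : B.IsSymm) (x : ι → ℝ) (j : ι) : inner B x (Pi.single j 1) = B.mulVec x j := by
  rw [inner_comm hB, inner_single_left]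

theorem formP_isSymm : (formP s).IsSymm := by
  ext (i | i | i) (j | j | j) <;> simp [formP, delta_comm]

theorem formQ_isSymm (c : Fin s → ℝ) : (formQ c).IsSymm := by
  ext (i | i | i) (j | j | j)
  · have := delta_mul_eq c i j
    simp only [formQ, Matrix.transpose_apply, Matrix.of_apply]
    rw [delta_comm j i, this]
  all_goals simp [formQ, delta_comm]

/-- The `u`-part of a tangent vector. -/
def uPart (x : Coord s → ℝ) : Fin s → ℝ := fun i => x (.inl i)

/-- The `u`-part of the covector associated to a tangent vector by `formQ`. -/
def qPart (c : Fin s → ℝ) (x : Coord s → ℝ) : Fin s → ℝ :=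
  fun i => c i * x (.inl i) + x (.inr (.inl i))

theorem formP_mulVec (x : Coord s → ℝ) :
    (formP s).mulVec x = Sum.elim (uPart x) 0 := by
  ext (i | i | i) <;> simp [formP, Matrix.mulVec, dotProduct, uPart, delta]

theorem formQ_mulVec (c : Fin s → ℝ) (x : Coord s → ℝ) :
    (formQ c).mulVec x = Sum.elim (qPart c x) (Sum.elim (uPart x) 0) := by
  ext (i | i | i) <;> simp [formQ, Matrix.mulVec, dotProduct, uPart, qPart, delta]

theorem inner_eq_dotProduct {ι : Type} [Fintype ι] (B : Matrix ι ι ℝ) (x y : ι → ℝ) :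
    inner B x y = x ⬝ᵥ B.mulVec y := by
  simp only [inner, dotProduct, Matrix.mulVec, Finset.mul_sum]
  exact Finset.sum_congr rfl fun i _ => Finset.sum_congr rfl fun j _ => by ring

theorem inner_formP (x y : Coord s → ℝ) : inner (formP s) x y = uPart x ⬝ᵥ uPart y := by
  rw [inner_eq_dotProduct, formP_mulVec]
  simp [dotProduct, uPart]

theorem inner_formQ (c : Fin s → ℝ) (x y : Coord s → ℝ) :
    inner (formQ c) x y = uPart x ⬝ᵥ qPart c y + (fun i => x (.inr (.inl i))) ⬝ᵥ uPart y := by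
  rw [inner_eq_dotProduct, formQ_mulVec]
  simp [dotProduct, uPart]

/-- The lower left block of the Jacobi operator. -/
def jacobiCorner (c : Fin s → ℝ) (x : Coord s → ℝ) : Matrix (Fin s) (Fin s) ℝ :=
  (uPart x ⬝ᵥ uPart x) • Matrix.diagonal c + inner (formQ c) x x • (1 : Matrix (Fin s) (Fin s) ℝ) -
    Matrix.vecMulVec (uPart x) (qPart c x) - Matrix.vecMulVec (qPart c x) (uPart x)

/-- Since `B` has no `v`-components, `φ` drops out: raising sends the `u`-slot to `v` and the
`t`-slot to `-t`. -/
theorem endOfForm_gF (B : Matrix (Coord s) (Coord s) ℝ) (P : Coord s → ℝ)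
    (K S : Matrix (Fin s) (Fin s) ℝ)
    (huu : ∀ i j, B (.inl j) (.inl i) = S i j) (htu : ∀ i j, B (.inr (.inl j)) (.inl i) = K i j)
    (hut : ∀ i j, B (.inl j) (.inr (.inl i)) = K i j)
    (htt : ∀ i j, B (.inr (.inl j)) (.inr (.inl i)) = 0)
    (hv : ∀ i j, B (.inr (.inr i)) j = 0) (hv' : ∀ i j, B j (.inr (.inr i)) = 0) :
    endOfForm (gF f P) B = blockNil K S := by
  rw [endOfForm, gF_inv]
  ext (i | i | i) (j | j | j) <;>
    simp [Matrix.mul_apply, gFInv, blockNil, huu, htu, hut, htt, hv, hv']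

theorem jacobi_gF (c : Fin s → ℝ) (P x : Coord s → ℝ) :
    jacobi (gF f P) (kulkarniNomizu (formP s) (formQ c)) x =
      blockNil (jacobiBlock (uPart x)) (jacobiCorner c x) := by
  rw [jacobi]
  simp only [eval_kulkarniNomizu, inner_single_left, inner_single_right formP_isSymm,
    inner_single_right (formQ_isSymm c)]
  apply endOfForm_gF <;> intro i j
  all_goals simp only [Matrix.of_apply, Matrix.mulVec_single_one, Matrix.col_apply, formP_mulVec,
    formQ_mulVec, inner_formP, Sum.elim_inl, Sum.elim_inr, formP_inr_left, formP_inr_right,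
    formQ_v_left, formQ_v_right, formQ_t_t, Pi.zero_apply, mul_zero, zero_mul, add_zero, sub_zero]
  · simp [formP, formQ, delta, jacobiCorner, Matrix.diagonal_apply, Matrix.one_apply,
      Matrix.vecMulVec_apply]
    ring
  · simp [formQ, delta, jacobiBlock, Matrix.one_apply, Matrix.vecMulVec_apply, mul_comm]
  · simp [formQ, delta, jacobiBlock, Matrix.one_apply, Matrix.vecMulVec_apply, mul_comm]

theorem skewOp_gF (c : Fin s → ℝ) (P : Coord s → ℝ) (e : (Coord s → ℝ) × (Coord s → ℝ)) :
    skewOp (gF f P) (kulkarniNomizu (formP s) (formQ c)) e =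
      blockNil (skewBlock (uPart e.1) (uPart e.2))
        (Matrix.vecMulVec (qPart c e.1) (uPart e.2) - Matrix.vecMulVec (uPart e.2) (qPart c e.1) +
          Matrix.vecMulVec (uPart e.1) (qPart c e.2) -
          Matrix.vecMulVec (qPart c e.2) (uPart e.1)) := by
  rw [skewOp]
  simp only [eval_kulkarniNomizu, inner_single_right formP_isSymm,
    inner_single_right (formQ_isSymm c), formP_mulVec, formQ_mulVec]
  apply endOfForm_gF <;> intro i j
  · simp [Matrix.vecMulVec_apply]; ring
  · simp [Matrix.vecMulVec_apply, skewBlock]; ring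
  · simp [Matrix.vecMulVec_apply, skewBlock]; ring
  · simp
  · simp
  · simp

/-! ### Signature -/

/-- The `t`-part of a tangent vector. -/
def tPart (x : Coord s → ℝ) : Fin s → ℝ := fun i => x (.inr (.inl i))

/-- The `v`-part of a tangent vector. -/
def vPart (x : Coord s → ℝ) : Fin s → ℝ := fun i => x (.inr (.inr i))

theorem inner_gF (P x y : Coord s → ℝ) :
    inner (gF f P) x y = metricPotential f P * (uPart x ⬝ᵥ uPart y) + uPart x ⬝ᵥ vPart y +
      vPart x ⬝ᵥ uPart y - tPart x ⬝ᵥ tPart y := by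
  have h : (gF f P).mulVec y = Sum.elim (metricPotential f P • uPart y + vPart y)
      (Sum.elim (-tPart y) (uPart y)) := by
    ext (i | i | i) <;>
      simp [gF, Matrix.mulVec, dotProduct, uPart, vPart, tPart, metricPotential]
  have hx : x = Sum.elim (uPart x) (Sum.elim (tPart x) (vPart x)) := by
    ext (i | i | i) <;> rfl
  rw [inner_eq_dotProduct, h]
  conv_lhs => rw [hx]
  simp only [sumElim_dotProduct_sumElim, dotProduct_add, dotProduct_smul, dotProduct_neg,
    smul_eq_mul]
  ring

theorem linearIndependent_of_orthogonal {ι κ : Type} [Fintype ι] [Fintype κ] [DecidableEq κ]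
    {G : Matrix ι ι ℝ} {b : κ → ι → ℝ} {ε : κ → ℝ} (hε : ∀ i, ε i ≠ 0)
    (hb : ∀ i j, inner G (b i) (b j) = if i = j then ε i else 0) : LinearIndependent ℝ b := by
  rw [Fintype.linearIndependent_iff]
  intro c hc i
  have h : inner G (b i) (∑ j, c j • b j) = c i * ε i := by
    simp only [inner_eq_dotProduct, Matrix.mulVec_sum, Matrix.mulVec_smul, dotProduct_sum,
      dotProduct_smul]
    simp only [← inner_eq_dotProduct, hb, smul_eq_mul]
    simp
  rw [hc, inner_eq_dotProduct, Matrix.mulVec_zero, dotProduct_zero] at h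
  exact (mul_eq_zero.mp h.symm).resolve_right (hε i)

/-- A `gF`-orthonormal frame. -/
def frame (f : Fin s → ℝ → ℝ) (P : Coord s → ℝ) : (Fin s ⊕ Fin s) ⊕ Fin s → Coord s → ℝ
  | .inl (.inl i) => Sum.elim 0 (Sum.elim (Pi.single i 1) 0)
  | .inl (.inr i) =>
      Sum.elim (Pi.single i 1) (Sum.elim 0 (((-1 - metricPotential f P) / 2) • Pi.single i 1))
  | .inr i =>
      Sum.elim (Pi.single i 1) (Sum.elim 0 (((1 - metricPotential f P) / 2) • Pi.single i 1))

theorem uPart_elim (u t v : Fin s → ℝ) : uPart (Sum.elim u (Sum.elim t v)) = u := rfl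
theorem tPart_elim (u t v : Fin s → ℝ) : tPart (Sum.elim u (Sum.elim t v)) = t := rfl
theorem vPart_elim (u t v : Fin s → ℝ) : vPart (Sum.elim u (Sum.elim t v)) = v := rfl

/-- The vector `∂uᵢ + a ∂vᵢ` has square `φ + 2 a`, and its product with `∂uᵢ + b ∂vᵢ` is `φ + a +
b`; the coefficients of `frame` make these `-1`, `1` and `0`. -/
theorem inner_frame (P : Coord s → ℝ) (a b : (Fin s ⊕ Fin s) ⊕ Fin s) :
    inner (gF f P) (frame f P a) (frame f P b) =
      if a = b then Sum.elim (fun _ => -1) (fun _ => 1) a else 0 := by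
  rw [inner_gF]
  rcases a with (i | i) | i <;> rcases b with (j | j) | j <;>
    simp only [frame, uPart_elim, tPart_elim, vPart_elim] <;> simp [Pi.single_apply]
  all_goals split_ifs <;> subst_vars <;> first | ring1 | simp_all

theorem hasSignature_gF (P : Coord s → ℝ) : HasSignature (gF f P) (2 * s) s := by
  let e : Fin (2 * s) ⊕ Fin s ≃ (Fin s ⊕ Fin s) ⊕ Fin s :=
    Equiv.sumCongr ((finCongr (two_mul s)).trans finSumFinEquiv.symm) (Equiv.refl _)
  have hb : ∀ i j, inner (gF f P) (frame f P (e i)) (frame f P (e j)) =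
      if i = j then Sum.elim (fun _ => -1) (fun _ => 1) i else 0 := by
    intro i j
    rw [inner_frame]
    simp only [e.injective.eq_iff]
    rcases i with i | i <;> rfl
  have hli := linearIndependent_of_orthogonal (b := fun i => frame f P (e i))
    (by rintro (i | i) <;> simp) hb
  have hcard : Fintype.card (Fin (2 * s) ⊕ Fin s) = Module.finrank ℝ (Coord s → ℝ) := by
    simp; ring
  refine ⟨Module.Basis.mk hli (le_of_eq (hli.span_eq_top_of_card_eq_finrank' hcard).symm), ?_⟩
  intro i j
  rw [Module.Basis.mk_apply, Module.Basis.mk_apply, hb]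

theorem contDiff_gF (hf : ∀ i, ContDiff ℝ ∞ (f i)) (a b : Coord s) :
    ContDiff ℝ ∞ fun P => gF f P a b := by
  have h : ContDiff ℝ ∞ (metricPotential f) := by
    have : ∀ k, ContDiff ℝ ∞ fun P : Coord s → ℝ => f k (P (.inl k)) := fun k =>
      (hf k).comp (contDiff_apply ℝ ℝ _)
    unfold metricPotential
    fun_prop
  rcases a with i | i | i <;> rcases b with j | j | j
  · by_cases hij : i = j
    · simp only [gF, Matrix.of_apply, if_pos hij]
      exact h
    · simpa only [gF, Matrix.of_apply, if_neg hij] using contDiff_const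
  all_goals exact contDiff_const

theorem isPseudoRiemannian_gF (hf : ∀ i, ContDiff ℝ ∞ (f i)) :
    IsPseudoRiemannian (gF f) (2 * s) s :=
  ⟨contDiff_gF hf, gF_isSymm, hasSignature_gF⟩

/-! ### Ranks of the curvature operators -/

theorem uPart_ne_zero_of_spacelike {P x : Coord s → ℝ} (h : 0 < inner (gF f P) x x) :
    uPart x ≠ 0 := by
  intro h0
  rw [inner_gF, h0] at h
  have : 0 ≤ tPart x ⬝ᵥ tPart x := Finset.sum_nonneg fun i _ => mul_self_nonneg _
  simp at h
  linarith

/-- A nontrivial combination of the pair has square `a² + b² > 0`, so its `u`-part is nonzero. -/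
theorem linearIndependent_uPart {P : Coord s → ℝ} {e : (Coord s → ℝ) × (Coord s → ℝ)}
    (he : e ∈ orthonormalPairs (gF f P) 1) : LinearIndependent ℝ ![uPart e.1, uPart e.2] := by
  obtain ⟨h1, h2, h3⟩ := he
  rw [LinearIndependent.pair_iff]
  intro a b hab
  have hu : uPart (a • e.1 + b • e.2) = 0 := hab
  have hi : inner (gF f P) (a • e.1 + b • e.2) (a • e.1 + b • e.2) = a * a + b * b := by
    have h3' := h3
    rw [inner_comm (gF_isSymm P)] at h3'
    simp only [inner_eq_dotProduct] at h1 h2 h3 h3' ⊢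
    simp only [Matrix.mulVec_add, Matrix.mulVec_smul, add_dotProduct, dotProduct_add,
      smul_dotProduct, dotProduct_smul, smul_eq_mul, h1, h2, h3, h3']
    ring
  by_contra hne
  refine uPart_ne_zero_of_spacelike (f := f) (P := P) ?_ hu
  rw [hi]
  rcases not_and_or.mp hne with h | h
  · exact add_pos_of_pos_of_nonneg (mul_self_pos.mpr h) (mul_self_nonneg b)
  · exact add_pos_of_nonneg_of_pos (mul_self_nonneg a) (mul_self_pos.mpr h)

/-- The Jacobi form of `x` vanishes at `(x, x)`; since `jacobiBlock ξ` kills `ξ`, only the corner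
term survives. This is the condition for clearing the corner. -/
theorem dotProduct_jacobiCorner (c : Fin s → ℝ) (x : Coord s → ℝ) :
    uPart x ⬝ᵥ (jacobiCorner c x).mulVec (uPart x) = 0 := by
  have h1 : (Matrix.diagonal c).mulVec (uPart x) + tPart x = qPart c x := by
    ext i
    simp [Matrix.mulVec_diagonal, uPart, tPart, qPart]
  have h2 := congrArg (uPart x ⬝ᵥ ·) h1
  simp only [dotProduct_add] at h2
  have h3 : inner (formQ c) x x = uPart x ⬝ᵥ qPart c x + tPart x ⬝ᵥ uPart x := inner_formQ c x x
  rw [jacobiCorner, h3, Matrix.sub_mulVec, Matrix.sub_mulVec, Matrix.add_mulVec,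
    Matrix.smul_mulVec, Matrix.smul_mulVec, Matrix.one_mulVec, Matrix.vecMulVec_mulVec,
    Matrix.vecMulVec_mulVec]
  simp only [dotProduct_sub, dotProduct_add, dotProduct_smul, smul_eq_mul,
    op_smul_eq_smul,
    dotProduct_comm (qPart c x) (uPart x), dotProduct_comm (tPart x) (uPart x)]
  linear_combination (uPart x ⬝ᵥ uPart x) * h2

theorem jacobi_weyl_gF_rank (hf : ∀ i, ContDiff ℝ ∞ (f i)) {P x : Coord s → ℝ}
    (hx : uPart x ≠ 0) :
    (jacobi (gF f P) (weyl (gF f) P) x).rank = 2 * (s - 1) ∧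
      (jacobi (gF f P) (weyl (gF f) P) x ^ 2).rank = s - 1 ∧
      jacobi (gF f P) (weyl (gF f) P) x ^ 3 = 0 := by
  obtain ⟨X, Y, hXY⟩ := exists_jacobiBlock_decomposition hx
    (dotProduct_jacobiCorner (coeffQ f P) x)
  rw [weyl_gF hf, jacobi_gF, rank_blockNil X Y hXY, blockNil_sq, rank_blockCorner,
    rank_neg_mul_self_of_symm (jacobiBlock_transpose _), rank_jacobiBlock hx, blockNil_cube]
  exact ⟨rfl, rfl, rfl⟩

theorem skewOp_weyl_gF_rank (hf : ∀ i, ContDiff ℝ ∞ (f i)) {P : Coord s → ℝ}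
    {e : (Coord s → ℝ) × (Coord s → ℝ)} (he : LinearIndependent ℝ ![uPart e.1, uPart e.2]) :
    (skewOp (gF f P) (weyl (gF f) P) e).rank = 4 ∧
      (skewOp (gF f P) (weyl (gF f) P) e ^ 2).rank = 2 ∧
      skewOp (gF f P) (weyl (gF f) P) e ^ 3 = 0 := by
  obtain ⟨X, Y, hXY⟩ := exists_skewBlock_decomposition he
    (qPart (coeffQ f P) e.1) (qPart (coeffQ f P) e.2)
  rw [weyl_gF hf, skewOp_gF, rank_blockNil X Y hXY, blockNil_sq, rank_blockCorner,
    rank_neg_mul_self_of_skew (skewBlock_transpose _ _), rank_skewBlock he, blockNil_cube]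
  exact ⟨rfl, rfl, rfl⟩

/-! ### Constancy of the Jordan form -/

theorem card_coord (s : ℕ) : Fintype.card (Coord s) = 3 * s := by
  simp; ring

theorem spacelike_jordanOsserman_gF (hs : 2 ≤ s) (hf : ∀ i, ContDiff ℝ ∞ (f i)) :
    ConformallySpacelikeJordanOsserman (gF f) := by
  refine fun P => ⟨nilpotentData (s - 1) 3, fun x hx => ?_⟩
  have hx1 : inner (gF f P) x x = 1 := hx
  obtain ⟨h1, h2, h3⟩ := jacobi_weyl_gF_rank hf (P := P)
    (uPart_ne_zero_of_spacelike (f := f) (P := P) (x := x) (by rw [hx1]; exact one_pos))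
  exact hasJordanForm_of_rank h3 h2 h1 (by rw [card_coord]; omega)

theorem spacelike_jordanIvanovPetrova_gF (hs : 2 ≤ s) (hf : ∀ i, ContDiff ℝ ∞ (f i)) :
    ConformallySpacelikeJordanIvanovPetrova (gF f) := by
  refine fun P => ⟨nilpotentData 2 (3 * s - 6), fun e he => ?_⟩
  obtain ⟨h1, h2, h3⟩ := skewOp_weyl_gF_rank hf (linearIndependent_uPart he)
  exact hasJordanForm_of_rank h3 h2 h1 (by rw [card_coord]; omega)

theorem not_timelike_jordanOsserman_gF (hs : 2 ≤ s) (hf : ∀ i, ContDiff ℝ ∞ (f i)) :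
    ¬ ConformallyTimelikeJordanOsserman (gF f) := by
  intro h
  obtain ⟨D, hD⟩ := h 0
  let i : Fin s := ⟨0, by omega⟩
  -- Two unit timelike vectors: `∂tᵢ`, with zero `u`-part, and one whose `u`-part is a basis vector.
  have ht := hD (frame f 0 (.inl (.inl i))) (by
    simp [pseudoSphere, inner_frame])
  have hm := hD (frame f 0 (.inl (.inr i))) (by
    simp [pseudoSphere, inner_frame])
  have h0 : jacobi (gF f 0) (weyl (gF f) 0) (frame f 0 (.inl (.inl i))) = 0 := by
    have hu : uPart (frame f 0 (.inl (.inl i))) = 0 := rfl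
    rw [weyl_gF hf, jacobi_gF, jacobiCorner, inner_formQ, hu]
    ext (a | a | a) (b | b | b) <;> simp [blockNil, jacobiBlock]
  rw [h0] at ht
  have hu : uPart (frame f 0 (.inl (.inr i))) ≠ 0 := by
    intro h
    simpa [uPart, frame] using congrFun h i
  have hr := (jacobi_weyl_gF_rank hf (P := 0) hu).1
  rw [ht.eq_zero_of_zero hm, Matrix.rank_zero] at hr
  omega

theorem not_timelike_jordanIvanovPetrova_gF (hs : 2 ≤ s) (hf : ∀ i, ContDiff ℝ ∞ (f i)) :
    ¬ ConformallyTimelikeJordanIvanovPetrova (gF f) := by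
  intro h
  obtain ⟨D, hD⟩ := h 0
  let i : Fin s := ⟨0, by omega⟩
  let j : Fin s := ⟨1, by omega⟩
  have hij : i ≠ j := by simp [i, j]
  -- `a = .inl` gives a plane of `t`-directions, where the operator is zero; `a = .inr` gives one
  -- with independent `u`-parts, where it has rank `4`.
  have pair : ∀ a : Fin s → Fin s ⊕ Fin s, a i ≠ a j →
      (frame f 0 (.inl (a i)), frame f 0 (.inl (a j))) ∈ orthonormalPairs (gF f 0) (-1) := by
    intro a ha
    refine ⟨?_, ?_, ?_⟩ <;> simp [inner_frame, ha]
  have ht := hD _ (pair .inl (by simpa using hij))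
  have hm := hD _ (pair .inr (by simpa using hij))
  have h0 : skewOp (gF f 0) (weyl (gF f) 0)
      (frame f 0 (.inl (.inl i)), frame f 0 (.inl (.inl j))) = 0 := by
    have hu : ∀ k, uPart (frame f 0 (.inl (.inl k))) = 0 := fun k => rfl
    rw [weyl_gF hf, skewOp_gF, hu, hu]
    ext (a | a | a) (b | b | b) <;> simp [blockNil, skewBlock]
  rw [h0] at ht
  have hu : LinearIndependent ℝ
      ![uPart (frame f 0 (.inl (.inr i))), uPart (frame f 0 (.inl (.inr j)))] := by
    rw [LinearIndependent.pair_iff]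
    intro a b hab
    have hi := congrFun hab i
    have hj := congrFun hab j
    simp [uPart, frame, hij, hij.symm] at hi hj
    exact ⟨hi, hj⟩
  have hr := (skewOp_weyl_gF_rank hf (P := 0)
    (e := (frame f 0 (.inl (.inr i)), frame f 0 (.inl (.inr j)))) hu).1
  rw [ht.eq_zero_of_zero hm, Matrix.rank_zero] at hr
  omega

end WeylJordan

end

theorem theorem4p2 (s : ℕ) (hs : 2 ≤ s) (f : Fin s → ℝ → ℝ) (hf : ∀ i, ContDiff ℝ ∞ (f i)) :
    WeylJordan.IsPseudoRiemannian (WeylJordan.gF f) (2 * s) s ∧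
    (∀ P x : WeylJordan.Coord s → ℝ, 0 < WeylJordan.inner (WeylJordan.gF f P) x x →
      let J := WeylJordan.jacobi (WeylJordan.gF f P) (WeylJordan.weyl (WeylJordan.gF f) P) x
      J.rank = 2 * s - 2 ∧ (J ^ 2).rank = s - 1 ∧ J ^ 3 = 0) ∧
    WeylJordan.ConformallySpacelikeJordanOsserman (WeylJordan.gF f) ∧
    ¬ WeylJordan.ConformallyTimelikeJordanOsserman (WeylJordan.gF f) ∧
    (∀ P : WeylJordan.Coord s → ℝ,
      ∀ e ∈ WeylJordan.orthonormalPairs (WeylJordan.gF f P) 1,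
      let T := WeylJordan.skewOp (WeylJordan.gF f P) (WeylJordan.weyl (WeylJordan.gF f) P) e
      T.rank = 4 ∧ (T ^ 2).rank = 2 ∧ T ^ 3 = 0) ∧
    WeylJordan.ConformallySpacelikeJordanIvanovPetrova (WeylJordan.gF f) ∧
    ¬ WeylJordan.ConformallyTimelikeJordanIvanovPetrova (WeylJordan.gF f) := by
  refine ⟨WeylJordan.isPseudoRiemannian_gF hf, fun P x hx => ?_,
    WeylJordan.spacelike_jordanOsserman_gF hs hf, WeylJordan.not_timelike_jordanOsserman_gF hs hf,
    fun P e he => WeylJordan.skewOp_weyl_gF_rank hf (WeylJordan.linearIndependent_uPart he),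
    WeylJordan.spacelike_jordanIvanovPetrova_gF hs hf,
    WeylJordan.not_timelike_jordanIvanovPetrova_gF hs hf⟩
  have h := WeylJordan.jacobi_weyl_gF_rank hf (P := P) (WeylJordan.uPart_ne_zero_of_spacelike hx)
  rwa [Nat.mul_sub_one] at h
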